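/- Let $S_n$ be the group of permutations $\sigma=\sigma_1\sigma_2\cdots\sigma_n$ of $\{1,\dots,n\}$, and let $\mathcal{D}^S_n\subseteq S_n$ be the set of derangements, i.e. of those $\sigma$ with $\sigma_i\neq i$ for all $i$. For $\sigma\in S_n$ let $\ell_A(\sigma)$ be its Coxeter length, the least number of simple transpositions $(i,i+1)$, $1\le i\le n-1$, whose product is $\sigma$; let $\mathrm{inv}(\sigma)=\#\{(i,j): i<j,\ \sigma_i>\sigma_j\}$; and let $\mathrm{maj}(\sigma)=\sum i$, summed over all $1\le i\le n-1$ with $\sigma_i>\sigma_{i+1}$. Put $[k]_q=1+q+\cdots+q^{k-1}$ and $[k]_q!=[1]_q[2]_q\cdots[k]_q$, with $[0]_q!=1$. Then for every $n\ge 1$, as an identity in the field $\mathbb{Q}(q)$ of rational functions in an indeterminate $q$, $$\sum_{\sigma\in\mathcal{D}^S_n}(-1)^{\ell_A(\sigma)}q^{\mathrm{maj}(\sigma)}=[n]_q!\sum_{k=0}^{n}\frac{(-1)^k}{[k]_q!}\,q^{\binom{k}{2}}\left(\frac{1-q}{1+q}\right)^{\lfloor (n-k)/2\rfloor},$$ and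 the same identity holds with $\mathrm{inv}(\sigma)$ in place of $\ell_A(\sigma)$. -/

import Mathlib

/-- The simple transpositions `(i, i+1)` of the symmetric group on `n` letters; the letters
`1, …, n` are the elements of `Fin n`, shifted by one. -/
def simpleTranspositions (n : ℕ) : Set (Equiv.Perm (Fin n)) :=
  {s | ∃ (i : Fin n) (h : (i : ℕ) + 1 < n), s = Equiv.swap i ⟨(i : ℕ) + 1, h⟩}

/-- The Coxeter length: the least number of simple transpositions whose product is `σ`. -/
noncomputable def coxeterLength {n : ℕ} (σ : Equiv.Perm (Fin n)) : ℕ :=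
  sInf {k | ∃ w : List (Equiv.Perm (Fin n)),
    w.length = k ∧ (∀ s ∈ w, s ∈ simpleTranspositions n) ∧ w.prod = σ}

/-- The number of inversions of `σ`. -/
def inversionNumber {n : ℕ} (σ : Equiv.Perm (Fin n)) : ℕ :=
  (Finset.univ.filter fun p : Fin n × Fin n => p.1 < p.2 ∧ σ p.2 < σ p.1).card

/-- The descents of `σ`; the element `i : Fin n` stands for the position `i + 1` in the word
`σ_1 ⋯ σ_n`. -/
def descentSet {n : ℕ} (σ : Equiv.Perm (Fin n)) : Finset (Fin n) :=
  Finset.univ.filter fun i : Fin n => ∃ h : (i : ℕ) + 1 < n, σ ⟨(i : ℕ) + 1, h⟩ < σ i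

/-- The major index of `σ`: the sum of its descent positions, numbered from one. -/
def majorIndex {n : ℕ} (σ : Equiv.Perm (Fin n)) : ℕ :=
  ∑ i ∈ descentSet σ, ((i : ℕ) + 1)

/-- The fixed-point-free permutations of `n` letters. -/
def derangementFinset (n : ℕ) : Finset (Equiv.Perm (Fin n)) :=
  Finset.univ.filter fun σ => σ ∈ derangements (Fin n)

/-- The `q`-integer `[k]_q = 1 + q + ⋯ + q^(k-1)`. -/
def qInteger {R : Type*} [CommSemiring R] (q : R) (k : ℕ) : R :=
  ∑ i ∈ Finset.range k, q ^ i

/-- The `q`-factorial `[k]_q! = [1]_q [2]_q ⋯ [k]_q`, with `[0]_q! = 1`. -/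
def qFactorial {R : Type*} [CommSemiring R] (q : R) (k : ℕ) : R :=
  ∏ i ∈ Finset.Icc 1 k, qInteger q i

/-! Both `(-1) ^ coxeterLength σ` and `(-1) ^ inversionNumber σ` equal the sign of `σ`, so the two
identities are one statement about `D n`, the sum of `sign σ * q ^ maj σ` over derangements. Let `W
n` be the same sum over all permutations.

A permutation is determined by its support, of size `k`, and a derangement `d` of `k` letters with
the same sign. Writing fixed points as `0`, subexcedances as negative and excedances as positive
letters keeps every descent, so `σ` becomes a shuffle of a fixed word with zeros. Summed over all
supports of size `k`, `q ^ maj` gives `q ^ maj d` times a Gaussian binomial (`sum_shuffleWord`).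
Hence `W n = ∑ k, gaussBinom q n k * D k` (`signedMajSum_univ_eq_sum_derangements`).

Exchanging the two largest values cancels all of `W (n + 2)` except the permutations where they are
adjacent; inserting them as a block gives a two-step recurrence (`signedMajSum_univ_add_two`) and
the closed form of `W n` (`signedMajSum_univ_eq`). After division by q-factorials the relation
between `W` and `D` is multiplication by a q-exponential series, which `qExp_mul_qExp_inv` inverts.
-/

/-! ### Sign, inversions and Coxeter length -/

lemma sign_eq_neg_one_pow_inversionNumber {n : ℕ} (σ : Equiv.Perm (Fin n)) :
    Equiv.Perm.sign σ = (-1) ^ inversionNumber σ := by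
  rw [Equiv.Perm.sign_eq_prod_prod_Ioi, inversionNumber, ← Finset.prod_const, Finset.prod_filter,
    ← Finset.univ_product_univ, Finset.prod_product]
  refine Finset.prod_congr rfl fun i _ => ?_
  rw [← Finset.filter_lt_eq_Ioi, Finset.prod_filter]
  refine Finset.prod_congr rfl fun j _ => ?_
  by_cases h : i < j
  · rcases lt_trichotomy (σ i) (σ j) with h' | h' | h'
    · simp [h, h', h'.not_gt]
    · exact absurd (σ.injective h') h.ne
    · simp [h, h', h'.not_gt]
  · simp [h]

lemma exists_simpleTranspositions_word {n : ℕ} (σ : Equiv.Perm (Fin n)) :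
    ∃ w : List (Equiv.Perm (Fin n)), (∀ s ∈ w, s ∈ simpleTranspositions n) ∧ w.prod = σ := by
  cases n with
  | zero => exact ⟨[], by simp, Subsingleton.elim _ _⟩
  | succ n =>
    have h : σ ∈ Submonoid.closure
        (Set.range fun i : Fin n ↦ Equiv.swap i.castSucc i.succ) := by
      rw [Equiv.Perm.mclosure_swap_castSucc_succ]; trivial
    obtain ⟨w, hw, hp⟩ := Submonoid.exists_list_of_mem_closure h
    refine ⟨w, fun s hs => ?_, hp⟩
    obtain ⟨i, rfl⟩ := hw s hs
    exact ⟨i.castSucc, by simp, rfl⟩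

lemma sign_eq_neg_one_pow_coxeterLength {n : ℕ} (σ : Equiv.Perm (Fin n)) :
    Equiv.Perm.sign σ = (-1) ^ coxeterLength σ := by
  -- Nonemptiness is what makes the infimum attained by an actual word; `sInf ∅` is `0` by default.
  have hne : {k | ∃ w : List (Equiv.Perm (Fin n)),
      w.length = k ∧ (∀ s ∈ w, s ∈ simpleTranspositions n) ∧ w.prod = σ}.Nonempty := by
    obtain ⟨w, hw, hp⟩ := exists_simpleTranspositions_word σ
    exact ⟨_, w, rfl, hw, hp⟩
  obtain ⟨w, hl, hw, hp⟩ := Nat.sInf_mem hne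
  rw [coxeterLength, ← hl, ← hp]
  refine Equiv.Perm.sign_prod_list_swap fun s hs => ?_
  obtain ⟨i, h, rfl⟩ := hw s hs
  exact ⟨_, _, by simp [Fin.ext_iff], rfl⟩

/-! ### The major index of words -/

/-- The major index of the word `w 0, …, w (n - 1)`. -/
def wordMajorIndex {α : Type*} [LinearOrder α] (n : ℕ) (w : ℕ → α) : ℕ :=
  ∑ i ∈ Finset.range n, if w i < w (i - 1) then i else 0

lemma wordMajorIndex_succ {α : Type*} [LinearOrder α] (n : ℕ) (w : ℕ → α) :
    wordMajorIndex (n + 1) w = wordMajorIndex n w + if w n < w (n - 1) then n else 0 :=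
  Finset.sum_range_succ _ _

lemma wordMajorIndex_congr {α β : Type*} [LinearOrder α] [LinearOrder β] {n : ℕ} {w : ℕ → α}
    {u : ℕ → β} (h : ∀ i, i + 1 < n → (w (i + 1) < w i ↔ u (i + 1) < u i)) :
    wordMajorIndex n w = wordMajorIndex n u := by
  refine Finset.sum_congr rfl fun i hi => ?_
  cases i with
  | zero => simp
  | succ i => simp [h i (Finset.mem_range.1 hi)]

lemma wordMajorIndex_eq_of_eqOn {α : Type*} [LinearOrder α] {n : ℕ} {w u : ℕ → α}
    (h : ∀ i < n, w i = u i) : wordMajorIndex n w = wordMajorIndex n u :=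
  wordMajorIndex_congr fun i hi => by rw [h i (by omega), h (i + 1) hi]

/-- The one-line notation of a permutation, as a word of natural numbers. -/
def permWord {n : ℕ} (σ : Equiv.Perm (Fin n)) (i : ℕ) : ℕ :=
  if h : i < n then σ ⟨i, h⟩ else 0

lemma permWord_of_lt {n : ℕ} (σ : Equiv.Perm (Fin n)) {i : ℕ} (h : i < n) :
    permWord σ i = σ ⟨i, h⟩ := dif_pos h

lemma permWord_val {n : ℕ} (σ : Equiv.Perm (Fin n)) (i : Fin n) :
    permWord σ i = σ i := dif_pos i.2

/-- `descentSet` records a descent at its left index `i` with weight `i + 1`, `wordMajorIndex` at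
its right index with that index as weight. The term of index `0` in the latter vanishes. -/
lemma majorIndex_eq_wordMajorIndex {n : ℕ} (σ : Equiv.Perm (Fin n)) :
    majorIndex σ = wordMajorIndex n (permWord σ) := by
  cases n with
  | zero => simp [majorIndex, wordMajorIndex, descentSet]
  | succ n =>
    rw [wordMajorIndex, Finset.sum_range_succ', majorIndex, descentSet, Finset.sum_filter,
      Fin.sum_univ_castSucc, ← Fin.sum_univ_eq_sum_range
        (fun i => if permWord σ (i + 1) < permWord σ (i + 1 - 1) then i + 1 else 0)]
    simp only [ite_self, add_zero]
    rw [if_neg (by simp), add_zero]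
    refine Finset.sum_congr rfl fun i _ => ?_
    have h1 := permWord_val σ i.castSucc
    have h2 := permWord_val σ i.succ
    rw [Fin.val_castSucc] at h1
    rw [Fin.val_succ] at h2
    rw [Nat.add_sub_cancel, h1, h2]
    refine if_congr ⟨fun ⟨h, h'⟩ => h', fun h => ⟨by simp, h⟩⟩ rfl rfl

/-! ### Gaussian binomial coefficients -/

/-- The Gaussian binomial coefficient. -/
def gaussBinom {R : Type*} [CommSemiring R] (q : R) : ℕ → ℕ → R
  | _, 0 => 1
  | 0, _ + 1 => 0
  | n + 1, k + 1 => gaussBinom q n k + q ^ (k + 1) * gaussBinom q n (k + 1)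

section gaussBinom

variable {R : Type*} [CommRing R] (q : R)

@[simp] lemma gaussBinom_zero_right (n : ℕ) : gaussBinom q n 0 = 1 := by
  cases n <;> simp [gaussBinom]

lemma gaussBinom_succ_succ (n k : ℕ) : gaussBinom q (n + 1) (k + 1) =
    gaussBinom q n k + q ^ (k + 1) * gaussBinom q n (k + 1) := by
  simp [gaussBinom]

lemma gaussBinom_eq_zero_of_lt {n k : ℕ} (h : n < k) : gaussBinom q n k = 0 := by
  induction n generalizing k with
  | zero => obtain ⟨k, rfl⟩ := Nat.exists_eq_succ_of_ne_zero (by omega : k ≠ 0); simp [gaussBinom]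
  | succ n ih =>
    obtain ⟨k, rfl⟩ := Nat.exists_eq_succ_of_ne_zero (by omega : k ≠ 0)
    rw [Nat.succ_eq_add_one, gaussBinom_succ_succ, ih (by omega), ih (by omega)]; simp

/-- The ratio of neighbouring Gaussian binomials in division-free form, valid in any commutative
ring. -/
lemma one_sub_pow_mul_gaussBinom (k m : ℕ) :
    (1 - q ^ (k + 1)) * gaussBinom q (k + m) (k + 1) = (1 - q ^ m) * gaussBinom q (k + m) k := by
  induction h : k + m generalizing k m with
  | zero =>
    obtain ⟨rfl, rfl⟩ : k = 0 ∧ m = 0 := by omega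
    simp [gaussBinom]
  | succ n ih =>
    cases m with
    | zero => rw [gaussBinom_eq_zero_of_lt q (by omega : n + 1 < k + 1)]; simp
    | succ m =>
      cases k with
      | zero =>
        have h1 := ih 0 m (by omega)
        rw [gaussBinom_succ_succ]
        simp only [zero_add, gaussBinom_zero_right] at h1 ⊢
        linear_combination q * h1
      | succ k =>
        have h1 := ih (k + 1) m (by omega)
        have h2 := ih k (m + 1) (by omega)
        rw [gaussBinom_succ_succ, gaussBinom_succ_succ]
        linear_combination q ^ (k + 2) * h1 + h2

end gaussBinom

/-! ### Shuffles of a word with zeros -/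

/-- The word obtained by writing the letters `v 0, v 1, …` at the positions in `P` and zeros
elsewhere. -/
def shuffleWord (v : ℕ → ℤ) (P : Finset ℕ) (i : ℕ) : ℤ :=
  if i ∈ P then v (P.filter (· < i)).card else 0

lemma shuffleWord_of_mem (v : ℕ → ℤ) {P : Finset ℕ} {i : ℕ} (h : i ∈ P) :
    shuffleWord v P i = v (P.filter (· < i)).card := if_pos h

lemma shuffleWord_of_notMem (v : ℕ → ℤ) {P : Finset ℕ} {i : ℕ} (h : i ∉ P) :
    shuffleWord v P i = 0 := if_neg h

lemma shuffleWord_insert_of_lt (v : ℕ → ℤ) {P : Finset ℕ} {n i : ℕ} (h : i < n) :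
    shuffleWord v (insert n P) i = shuffleWord v P i := by
  simp [shuffleWord, Finset.filter_insert, h.ne, h.not_gt]

lemma shuffleWord_insert_self (v : ℕ → ℤ) {P : Finset ℕ} {n : ℕ} (hP : P ⊆ Finset.range n) :
    shuffleWord v (insert n P) n = v P.card := by
  rw [shuffleWord_of_mem v (Finset.mem_insert_self _ _), Finset.filter_insert,
    if_neg (lt_irrefl n), Finset.filter_true_of_mem fun i hi => Finset.mem_range.1 (hP hi)]

section shuffle

variable {R : Type*} [CommRing R] (q : R) (v : ℕ → ℤ)

/-- The sum of `q ^ maj` over the shuffles of `v 0, …, v (k - 1)` with zeros that have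
length `n + 1` and end in a zero. -/
def shuffleSumZero (n k : ℕ) : R :=
  ∑ P ∈ (Finset.range n).powersetCard k, q ^ wordMajorIndex (n + 1) (shuffleWord v P)

/-- The sum of `q ^ maj` over the shuffles of `v 0, …, v k` with zeros that have length `n + 1`
and end in `v k`. -/
def shuffleSumLetter (n k : ℕ) : R :=
  ∑ P ∈ (Finset.range n).powersetCard k,
    q ^ wordMajorIndex (n + 1) (shuffleWord v (insert n P))

lemma sum_powersetCard_range_succ {M : Type*} [AddCommMonoid M] (n k : ℕ) (f : Finset ℕ → M) :
    ∑ P ∈ (Finset.range (n + 1)).powersetCard (k + 1), f P =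
      ∑ P ∈ (Finset.range n).powersetCard (k + 1), f P +
        ∑ P ∈ (Finset.range n).powersetCard k, f (insert n P) := by
  have hmem : ∀ {j} {P : Finset ℕ}, P ∈ (Finset.range n).powersetCard j → n ∉ P :=
    fun hP hn => Finset.notMem_range_self ((Finset.mem_powersetCard.1 hP).1 hn)
  rw [Finset.range_add_one, Finset.powersetCard_succ_insert Finset.notMem_range_self,
    Finset.sum_union, Finset.sum_image]
  · intro P hP Q hQ h
    rw [← Finset.erase_insert (hmem hP), ← Finset.erase_insert (hmem hQ), h]
  · rw [Finset.disjoint_right]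
    intro P hP hP'
    obtain ⟨Q, -, rfl⟩ := Finset.mem_image.1 hP
    exact hmem hP' (Finset.mem_insert_self _ _)

lemma shuffleWord_eq_zero_of_le {P : Finset ℕ} {n i : ℕ} (hP : P ⊆ Finset.range n) (h : n ≤ i) :
    shuffleWord v P i = 0 :=
  shuffleWord_of_notMem v fun hi => (Finset.mem_range.1 (hP hi)).not_ge h

/-- Delete the final zero: the letter before it is a zero, giving no descent, or `v k`, giving one
exactly when `v k` is positive. -/
lemma shuffleSumZero_succ_succ (n k : ℕ) :
    shuffleSumZero q v (n + 1) (k + 1) = shuffleSumZero q v n (k + 1) +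
      (if 0 < v k then q ^ (n + 1) else 1) * shuffleSumLetter q v n k := by
  rw [shuffleSumZero, sum_powersetCard_range_succ, shuffleSumZero, shuffleSumLetter,
    Finset.mul_sum]
  congr 1
  · refine Finset.sum_congr rfl fun P hP => ?_
    obtain ⟨hP, -⟩ := Finset.mem_powersetCard.1 hP
    rw [wordMajorIndex_succ (n + 1), shuffleWord_eq_zero_of_le v hP (by omega),
      shuffleWord_eq_zero_of_le v hP (by omega)]
    simp
  · refine Finset.sum_congr rfl fun P hP => ?_
    obtain ⟨hP, hc⟩ := Finset.mem_powersetCard.1 hP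
    rw [wordMajorIndex_succ (n + 1), Nat.add_sub_cancel, shuffleWord_insert_self v hP, hc,
      shuffleWord_of_notMem (i := n + 1) v, pow_add, mul_comm]
    · congr 1
      split_ifs <;> simp
    · intro h
      rcases Finset.mem_insert.1 h with h | h
      · omega
      · have := Finset.mem_range.1 (hP h); omega

lemma shuffleSumLetter_succ_succ (n k : ℕ) :
    shuffleSumLetter q v (n + 1) (k + 1) =
      (if v (k + 1) < 0 then q ^ (n + 1) else 1) * shuffleSumZero q v n (k + 1) +
      (if v (k + 1) < v k then q ^ (n + 1) else 1) * shuffleSumLetter q v n k := by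
  have key : ∀ P ⊆ Finset.range (n + 1), P.card = k + 1 →
      q ^ wordMajorIndex (n + 1 + 1) (shuffleWord v (insert (n + 1) P)) =
        (if v (k + 1) < shuffleWord v P n then q ^ (n + 1) else 1) *
          q ^ wordMajorIndex (n + 1) (shuffleWord v P) := by
    intro P hP hc
    rw [wordMajorIndex_succ (n + 1), shuffleWord_insert_self v hP, Nat.add_sub_cancel,
      shuffleWord_insert_of_lt v (Nat.lt_succ_self n), hc,
      wordMajorIndex_eq_of_eqOn fun i hi => shuffleWord_insert_of_lt v hi, pow_add, mul_comm]
    congr 1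
    split_ifs <;> simp
  rw [shuffleSumLetter, sum_powersetCard_range_succ, shuffleSumZero, shuffleSumLetter,
    Finset.mul_sum, Finset.mul_sum]
  congr 1
  · refine Finset.sum_congr rfl fun P hP => ?_
    obtain ⟨hP, hc⟩ := Finset.mem_powersetCard.1 hP
    rw [key P (hP.trans (Finset.range_mono (Nat.le_succ n))) hc,
      shuffleWord_eq_zero_of_le v hP le_rfl]
  · refine Finset.sum_congr rfl fun P hP => ?_
    obtain ⟨hP, hc⟩ := Finset.mem_powersetCard.1 hP
    have hn : n ∉ P := fun h => Finset.notMem_range_self (hP h)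
    rw [key (insert n P), shuffleWord_insert_self v hP, hc]
    · rw [Finset.range_add_one]; exact Finset.insert_subset_insert _ hP
    · rw [Finset.card_insert_of_notMem hn, hc]

lemma wordMajorIndex_zeros (n : ℕ) : wordMajorIndex n (shuffleWord v ∅) = 0 := by
  simp [wordMajorIndex, shuffleWord]

lemma shuffleSumLetter_zero_right (n : ℕ) :
    shuffleSumLetter q v n 0 = if v 0 < 0 then q ^ n else 1 := by
  have h : wordMajorIndex n (shuffleWord v {n}) = 0 := by
    rw [← wordMajorIndex_zeros v n]
    exact wordMajorIndex_eq_of_eqOn fun i hi => shuffleWord_insert_of_lt (P := ∅) v hi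
  have h1 : shuffleWord v {n} n = v 0 := shuffleWord_insert_self v (Finset.empty_subset _)
  simp only [shuffleSumLetter, Finset.powersetCard_zero, Finset.sum_singleton,
    insert_empty_eq, wordMajorIndex_succ, h, h1, zero_add]
  cases n with
  | zero => simp
  | succ n =>
    rw [shuffleWord_of_notMem (i := n + 1 - 1) v (by simp)]
    split_ifs <;> simp

lemma powersetCard_empty_succ {α : Type*} (k : ℕ) :
    (∅ : Finset α).powersetCard (k + 1) = ∅ :=
  Finset.powersetCard_eq_empty.2 (by simp)

lemma shuffleSumZero_zero_succ (k : ℕ) : shuffleSumZero q v 0 (k + 1) = 0 := by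
  simp [shuffleSumZero, powersetCard_empty_succ]

lemma shuffleSumLetter_zero_succ (k : ℕ) : shuffleSumLetter q v 0 (k + 1) = 0 := by
  simp [shuffleSumLetter, powersetCard_empty_succ]

/-- The two Pascal rules differ by exactly `one_sub_pow_mul_gaussBinom`. -/
lemma gaussBinom_succ_succ' (n k : ℕ) : gaussBinom q (n + 1) (k + 1) =
    q ^ (n - k) * gaussBinom q n k + gaussBinom q n (k + 1) := by
  rcases lt_or_ge n k with h | h
  · rw [gaussBinom_eq_zero_of_lt q h, gaussBinom_eq_zero_of_lt q (by omega : n < k + 1),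
      gaussBinom_eq_zero_of_lt q (by omega)]
    simp
  · obtain ⟨m, rfl⟩ := Nat.exists_eq_add_of_le h
    rw [gaussBinom_succ_succ, Nat.add_sub_cancel_left]
    linear_combination -one_sub_pow_mul_gaussBinom q k m

/-- Separating shuffles by their last letter closes the induction: the two sums satisfy a joint
recurrence, and each case of signs and descents is one of the two Pascal rules times a power of `q`.
-/
theorem shuffleSum_eq (n k : ℕ) (hv : ∀ j ≤ k, v j ≠ 0) :
    shuffleSumZero q v n (k + 1) = q ^ wordMajorIndex (k + 1) v *
      (if 0 < v k then q ^ (k + 1) else 1) * gaussBinom q n (k + 1) ∧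
    shuffleSumLetter q v n k = q ^ wordMajorIndex (k + 1) v *
      (if v k < 0 then q ^ (n - k) else 1) * gaussBinom q n k := by
  induction n generalizing k with
  | zero =>
    cases k with
    | zero =>
      simp [shuffleSumZero_zero_succ, shuffleSumLetter_zero_right, gaussBinom, wordMajorIndex]
    | succ k => simp [shuffleSumZero_zero_succ, shuffleSumLetter_zero_succ, gaussBinom]
  | succ n ih =>
    constructor
    · rw [shuffleSumZero_succ_succ, (ih k hv).1, (ih k hv).2]
      rcases lt_or_gt_of_ne (hv k le_rfl) with h | h
      · simp only [h, h.not_gt, if_true, if_false]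
        rw [gaussBinom_succ_succ']; ring
      · simp only [h, h.not_gt, if_true, if_false]
        rcases lt_or_ge n k with hn | hn
        · simp only [gaussBinom_eq_zero_of_lt q hn, gaussBinom_eq_zero_of_lt q
            (by omega : n < k + 1), gaussBinom_eq_zero_of_lt q (by omega : n + 1 < k + 1)]
          ring
        · obtain ⟨m, rfl⟩ := Nat.exists_eq_add_of_le hn
          rw [gaussBinom_succ_succ', Nat.add_sub_cancel_left]; ring
    · cases k with
      | zero =>
        rw [shuffleSumLetter_zero_right]
        simp [wordMajorIndex]
      | succ k =>
        have hv' : ∀ j ≤ k, v j ≠ 0 := fun j hj => hv j (by omega)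
        rw [shuffleSumLetter_succ_succ, (ih k hv').1, (ih k hv').2, wordMajorIndex_succ (k + 1),
          Nat.add_sub_cancel, Nat.add_sub_add_right]
        -- For `n < k` the exponent `n - k` truncates, but all the Gaussian binomials vanish.
        rcases lt_or_ge n k with hn | hn
        · simp only [gaussBinom_eq_zero_of_lt q hn, gaussBinom_eq_zero_of_lt q
            (by omega : n < k + 1), gaussBinom_eq_zero_of_lt q (by omega : n + 1 < k + 1)]
          ring
        obtain ⟨m, rfl⟩ := Nat.exists_eq_add_of_le hn
        rw [Nat.add_sub_cancel_left]
        have e1 := gaussBinom_succ_succ q (k + m) k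
        have e2 := gaussBinom_succ_succ' q (k + m) k
        rw [Nat.add_sub_cancel_left] at e2
        rcases lt_or_gt_of_ne (hv k (by omega)) with h0 | h0 <;>
        rcases lt_or_gt_of_ne (hv (k + 1) le_rfl) with h1 | h1
        · by_cases h : v (k + 1) < v k
          · simp only [h0, h1, h, h0.not_gt, if_true, if_false]
            linear_combination -q ^ (wordMajorIndex (k + 1) v + (k + 1 + m)) * e2
          · simp only [h0, h1, h, h0.not_gt, if_true, if_false]
            linear_combination -q ^ (wordMajorIndex (k + 1) v + m) * e1
        · simp only [h0, h1.not_gt, (h0.trans h1).not_gt, h0.not_gt, if_true, if_false]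
          linear_combination -q ^ wordMajorIndex (k + 1) v * e2
        · simp only [h0, h1, h1.trans h0, h0.not_gt, if_true, if_false]
          linear_combination -q ^ (wordMajorIndex (k + 1) v + (k + 1 + m)) * e1
        · by_cases h : v (k + 1) < v k
          · simp only [h0, h1.not_gt, h, h0.not_gt, if_true, if_false]
            linear_combination -q ^ (wordMajorIndex (k + 1) v + (k + 1)) * e2
          · simp only [h0, h1.not_gt, h, h0.not_gt, if_true, if_false]
            linear_combination -q ^ wordMajorIndex (k + 1) v * e1

/-- The sum of `q ^ maj` over all shuffles of a word of `k` nonzero letters with `n - k` zeros. -/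
theorem sum_shuffleWord (n k : ℕ) (hv : ∀ j < k, v j ≠ 0) :
    ∑ P ∈ (Finset.range n).powersetCard k, q ^ wordMajorIndex n (shuffleWord v P) =
      q ^ wordMajorIndex k v * gaussBinom q n k := by
  cases n with
  | zero => cases k <;> simp [gaussBinom, wordMajorIndex, powersetCard_empty_succ]
  | succ n =>
    cases k with
    | zero =>
      rw [Finset.powersetCard_zero, Finset.sum_singleton, wordMajorIndex_zeros]
      simp [wordMajorIndex]
    | succ k =>
      have h := shuffleSum_eq q v n k fun j hj => hv j (by omega)
      rw [sum_powersetCard_range_succ]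
      change shuffleSumZero q v n (k + 1) + shuffleSumLetter q v n k = _
      rw [h.1, h.2]
      rcases lt_or_gt_of_ne (hv k (by omega)) with h0 | h0
      · simp only [h0, h0.not_gt, if_true, if_false]
        rw [gaussBinom_succ_succ']; ring
      · simp only [h0, h0.not_gt, if_true, if_false]
        rw [gaussBinom_succ_succ]; ring

end shuffle

/-! ### Permutations as shuffles of a derangement with fixed points -/

open Equiv

/-- The letters of a permutation `d`, encoded so that the values below the diagonal are negative
and those above it are positive. -/
def diagonalWord {k : ℕ} (d : Perm (Fin k)) (j : ℕ) : ℤ :=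
  if h : j < k then
    if (d ⟨j, h⟩ : ℕ) < j then (d ⟨j, h⟩ : ℕ) - (k : ℤ) else (d ⟨j, h⟩ : ℕ) + 1
  else 0

lemma diagonalWord_val {k : ℕ} (d : Perm (Fin k)) (j : Fin k) :
    diagonalWord d j = if d j < j then ((d j : ℕ) : ℤ) - k else (d j : ℕ) + 1 := by
  simp [diagonalWord]

lemma diagonalWord_ne_zero {k : ℕ} (d : Perm (Fin k)) {j : ℕ} (h : j < k) :
    diagonalWord d j ≠ 0 := by
  have := (d ⟨j, h⟩).2
  simp only [diagonalWord, h, dite_true]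
  split_ifs <;> omega

section

variable {n k : ℕ} (e : Fin k ↪o Fin n)

/-- The positions of the range of an order embedding. -/
def positions : Finset ℕ := (Finset.univ.map e.toEmbedding).map Fin.valEmbedding

lemma mem_positions {i : Fin n} : (i : ℕ) ∈ positions e ↔ ∃ j, e j = i := by
  simp [positions, Fin.val_inj]

lemma card_positions_filter (j : Fin k) :
    ((positions e).filter (· < (e j : ℕ))).card = j := by
  rw [positions, Finset.map_map, Finset.filter_map, Finset.card_map]
  simp only [Function.comp_def, Function.Embedding.trans_apply, Fin.valEmbedding_apply,
    RelEmbedding.coe_toEmbedding, Fin.val_fin_lt, OrderEmbedding.lt_iff_lt]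
  rw [Finset.filter_gt_eq_Iio, Fin.card_Iio]

lemma shuffleWord_positions_apply (v : ℕ → ℤ) (j : Fin k) :
    shuffleWord v (positions e) (e j) = v j := by
  rw [shuffleWord_of_mem _ ((mem_positions e).2 ⟨j, rfl⟩), card_positions_filter]

lemma shuffleWord_positions_of_notMem (v : ℕ → ℤ) {i : Fin n} (h : ¬ ∃ j, e j = i) :
    shuffleWord v (positions e) i = 0 :=
  shuffleWord_of_notMem _ fun hi => h ((mem_positions e).1 hi)

/-- A permutation and the shuffle of its derangement part with zeros have the same major index. -/
lemma majorIndex_eq_shuffleWord {d : Perm (Fin k)} (hd : ∀ j, d j ≠ j) {σ : Perm (Fin n)}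
    (hσ : ∀ j, σ (e j) = e (d j)) (hfix : ∀ i, (¬ ∃ j, e j = i) → σ i = i) :
    majorIndex σ = wordMajorIndex n (shuffleWord (diagonalWord d) (positions e)) := by
  rw [majorIndex_eq_wordMajorIndex]
  refine wordMajorIndex_congr fun i hi => ?_
  obtain ⟨a, ha⟩ : ∃ a : Fin n, (a : ℕ) = i := ⟨⟨i, by omega⟩, rfl⟩
  obtain ⟨b, hb⟩ : ∃ b : Fin n, (b : ℕ) = i + 1 := ⟨⟨i + 1, by omega⟩, rfl⟩
  rw [← ha] at hb ⊢
  rw [← hb, permWord_val, permWord_val, ← Fin.lt_def]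
  have hab : a < b := by rw [Fin.lt_def]; omega
  by_cases hA : ∃ j, e j = a <;> by_cases hB : ∃ j, e j = b
  · obtain ⟨j, rfl⟩ := hA
    obtain ⟨l, rfl⟩ := hB
    rw [hσ, hσ, e.lt_iff_lt, shuffleWord_positions_apply, shuffleWord_positions_apply,
      diagonalWord_val, diagonalWord_val]
    have hjl : j < l := e.lt_iff_lt.1 hab
    -- `e j` and `e l` are consecutive, so no index lies between `j` and `l`. Hence an excedance at
    -- `j` followed by a subexcedance at `l` is a descent, and the opposite order an ascent, as the
    -- encoded signs say.
    have hadj : (l : ℕ) = j + 1 := by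
      by_contra hne
      have h1 : j < (⟨j + 1, by omega⟩ : Fin k) := by simp [Fin.lt_def]
      have h2 : (⟨j + 1, by omega⟩ : Fin k) < l := by rw [Fin.lt_def] at hjl ⊢; simp; omega
      have h1' := e.lt_iff_lt.2 h1
      have h2' := e.lt_iff_lt.2 h2
      rw [Fin.lt_def] at h1' h2'
      omega
    have hj := hd j
    have hl := hd l
    have := (d j).2
    have := (d l).2
    simp only [Fin.lt_def, ne_eq, Fin.ext_iff] at *
    split_ifs <;> omega
  · obtain ⟨j, rfl⟩ := hA
    rw [hσ, hfix b hB, shuffleWord_positions_apply, shuffleWord_positions_of_notMem e _ hB,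
      diagonalWord_val]
    -- The value `b` is taken by the fixed point `b`, so exceeding `b` is the same as exceeding its
    -- predecessor `e j`.
    have h1 : b < e (d j) ↔ j < d j := by
      rw [← e.lt_iff_lt]
      have : e (d j) ≠ b := fun h => hB ⟨_, h⟩
      rw [Fin.lt_def, Fin.lt_def]
      rw [ne_eq, Fin.ext_iff] at this
      omega
    rw [h1]
    have hj := hd j
    have := (d j).2
    simp only [Fin.lt_def, ne_eq, Fin.ext_iff] at *
    split_ifs <;> omega
  · obtain ⟨j, rfl⟩ := hB
    rw [hσ, hfix a hA, shuffleWord_positions_apply, shuffleWord_positions_of_notMem e _ hA,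
      diagonalWord_val]
    have h1 : e (d j) < a ↔ d j < j := by
      rw [← e.lt_iff_lt]
      have : e (d j) ≠ a := fun h => hA ⟨_, h⟩
      rw [Fin.lt_def, Fin.lt_def]
      rw [ne_eq, Fin.ext_iff] at this
      omega
    rw [h1]
    have := (d j).2
    simp only [Fin.lt_def] at *
    split_ifs <;> omega
  · rw [hfix a hA, hfix b hB, shuffleWord_positions_of_notMem e _ hA,
      shuffleWord_positions_of_notMem e _ hB]
    simp [hab.le]

end

lemma majorIndex_eq_diagonalWord {k : ℕ} {d : Perm (Fin k)} (hd : ∀ j, d j ≠ j) :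
    majorIndex d = wordMajorIndex k (diagonalWord d) := by
  rw [majorIndex_eq_shuffleWord (RelEmbedding.refl _) hd (fun _ => rfl)
    fun i hi => absurd ⟨i, rfl⟩ hi]
  exact wordMajorIndex_eq_of_eqOn fun i hi =>
    shuffleWord_positions_apply (RelEmbedding.refl _) _ ⟨i, hi⟩

section

variable {R : Type*} [CommRing R] (q : R)

/-- The signed generating function of the major index over a set of permutations. -/
def signedMajSum {n : ℕ} (S : Finset (Perm (Fin n))) : R :=
  ∑ σ ∈ S, ((Perm.sign σ : ℤ) : R) * q ^ majorIndex σ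

lemma mem_derangementFinset {n : ℕ} {σ : Perm (Fin n)} :
    σ ∈ derangementFinset n ↔ ∀ i, σ i ≠ i := by
  rw [derangementFinset, Finset.mem_filter]
  exact and_iff_right (Finset.mem_univ _)

/-- The increasing enumeration of `P` turns derangements of `Fin P.card` into permutations with
support `P` through `extendDomain`, which keeps the sign. -/
lemma signedMajSum_support_eq {n : ℕ} (P : Finset (Fin n)) :
    signedMajSum q (Finset.univ.filter fun σ : Perm (Fin n) => σ.support = P) =
      ∑ d ∈ derangementFinset P.card, ((Perm.sign d : ℤ) : R) *
        q ^ wordMajorIndex n (shuffleWord (diagonalWord d) (P.map Fin.valEmbedding)) := by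
  set f : Fin P.card ≃ {i // i ∈ P} := (P.orderIsoOfFin rfl).toEquiv
  have hf : ∀ j, (f j : Fin n) = P.orderEmbOfFin rfl j := fun _ => rfl
  have hpos : positions (P.orderEmbOfFin rfl) = P.map Fin.valEmbedding := by
    rw [positions, Finset.map_orderEmbOfFin_univ]
  have hrange : ∀ i, (∃ j, P.orderEmbOfFin rfl j = i) ↔ i ∈ P := fun i => by
    rw [← Set.mem_range, Finset.range_orderEmbOfFin, Finset.mem_coe]
  symm
  refine Finset.sum_bij (fun d _ => d.extendDomain f) ?_ ?_ ?_ ?_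
  · intro d hd
    rw [mem_derangementFinset] at hd
    rw [Finset.mem_filter]
    refine ⟨Finset.mem_univ _, ?_⟩
    ext i
    rw [Perm.mem_support]
    constructor
    · intro h
      by_contra hi
      exact h (Perm.extendDomain_apply_not_subtype _ _ hi)
    · intro hi
      obtain ⟨j, hj⟩ := f.surjective ⟨i, hi⟩
      have : (f j : Fin n) = i := by rw [hj]
      rw [← this, Perm.extendDomain_apply_image, ne_eq, Subtype.coe_inj, f.apply_eq_iff_eq]
      exact hd j
  · intro d _ d' _ h
    exact Perm.extendDomainHom_injective f h
  · intro σ hσ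
    have hs : σ.support = P := (Finset.mem_filter.1 hσ).2
    have hmem : ∀ i, σ i ∈ P ↔ i ∈ P := fun i => by rw [← hs, Perm.apply_mem_support]
    refine ⟨f.symm.permCongr (σ.subtypePerm hmem), ?_, ?_⟩
    · rw [mem_derangementFinset]
      intro j hj
      have h1 : f (f.symm.permCongr (σ.subtypePerm hmem) j) = f j := by rw [hj]
      have h2 : σ (f j) = f j := by
        simpa [Equiv.permCongr_apply, Subtype.ext_iff] using h1
      have : (f j : Fin n) ∈ σ.support := by rw [hs]; exact (f j).2
      exact Perm.mem_support.1 this h2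
    · ext1 i
      by_cases hi : i ∈ P
      · obtain ⟨j, hj⟩ := f.surjective ⟨i, hi⟩
        have : (f j : Fin n) = i := by rw [hj]
        rw [← this, Perm.extendDomain_apply_image]
        simp [Equiv.permCongr_apply]
      · rw [Perm.extendDomain_apply_not_subtype _ _ hi]
        rw [← hs, Perm.notMem_support] at hi
        exact hi.symm
  · intro d hd
    rw [mem_derangementFinset] at hd
    rw [Perm.sign_extendDomain, ← hpos, ← majorIndex_eq_shuffleWord _ hd]
    · intro j
      rw [← hf, ← hf, Perm.extendDomain_apply_image]
    · intro i hi
      rw [hrange] at hi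
      exact Perm.extendDomain_apply_not_subtype _ _ hi

theorem signedMajSum_univ_eq_sum_derangements (n : ℕ) :
    signedMajSum q (Finset.univ : Finset (Perm (Fin n))) =
      ∑ k ∈ Finset.range (n + 1), gaussBinom q n k * signedMajSum q (derangementFinset k) := by
  have h1 : signedMajSum q (Finset.univ : Finset (Perm (Fin n))) =
      ∑ P : Finset (Fin n), signedMajSum q
        (Finset.univ.filter fun σ : Perm (Fin n) => σ.support = P) :=
    (Finset.sum_fiberwise _ _ _).symm
  rw [h1, ← Finset.powerset_univ, Finset.sum_powerset, Finset.card_univ, Fintype.card_fin]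
  refine Finset.sum_congr rfl fun k _ => ?_
  have h2 : ∀ P ∈ Finset.powersetCard k (Finset.univ : Finset (Fin n)),
      signedMajSum q (Finset.univ.filter fun σ : Perm (Fin n) => σ.support = P) =
      ∑ d ∈ derangementFinset k, ((Perm.sign d : ℤ) : R) *
        q ^ wordMajorIndex n (shuffleWord (diagonalWord d) (P.map Fin.valEmbedding)) := by
    intro P hP
    obtain rfl := (Finset.mem_powersetCard.1 hP).2
    exact signedMajSum_support_eq q P
  have h3 : Finset.powersetCard k (Finset.range n) =
      (Finset.powersetCard k (Finset.univ : Finset (Fin n))).map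
        (Finset.mapEmbedding Fin.valEmbedding).toEmbedding := by
    rw [← Finset.powersetCard_map, Fin.map_valEmbedding_univ, Nat.Iio_eq_range]
  rw [Finset.sum_congr rfl h2, Finset.sum_comm, signedMajSum, Finset.mul_sum]
  refine Finset.sum_congr rfl fun d hd => ?_
  rw [← Finset.mul_sum, majorIndex_eq_diagonalWord (mem_derangementFinset.1 hd), mul_left_comm,
    mul_comm (gaussBinom q n k),
    ← sum_shuffleWord q (diagonalWord d) n k fun j hj => diagonalWord_ne_zero d hj, h3,
    Finset.sum_map]
  rfl

end

/-! ### The signed major index over the whole symmetric group -/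

/-- The word obtained by inserting the letters `a b` before position `p` of `w`. -/
def blockWord (p a b : ℕ) (w : ℕ → ℕ) (i : ℕ) : ℕ :=
  if i < p then w i else if i = p then a else if i = p + 1 then b else w (i - 2)

lemma blockWord_of_lt {p a b i : ℕ} (w : ℕ → ℕ) (h : i < p) : blockWord p a b w i = w i :=
  if_pos h

lemma blockWord_self (p a b : ℕ) (w : ℕ → ℕ) : blockWord p a b w p = a := by simp [blockWord]

lemma blockWord_succ (p a b : ℕ) (w : ℕ → ℕ) : blockWord p a b w (p + 1) = b := by
  simp [blockWord]

lemma blockWord_add_two {p a b i : ℕ} (w : ℕ → ℕ) (h : p ≤ i) :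
    blockWord p a b w (i + 2) = w i := by
  simp only [blockWord]
  rw [if_neg (by omega), if_neg (by omega), if_neg (by omega), Nat.add_sub_cancel]

lemma wordMajorIndex_blockWord_end {N a b : ℕ} {w : ℕ → ℕ} (ha : ∀ i < N, w i < a) :
    wordMajorIndex (N + 2) (blockWord N a b w) =
      wordMajorIndex N w + if b < a then N + 1 else 0 := by
  rw [wordMajorIndex_succ, wordMajorIndex_succ, blockWord_succ, Nat.add_sub_cancel, blockWord_self,
    wordMajorIndex_eq_of_eqOn fun i hi => blockWord_of_lt (a := a) (b := b) w hi]
  congr 1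
  cases N with
  | zero => simp
  | succ N =>
    rw [Nat.add_sub_cancel, blockWord_of_lt w (Nat.lt_succ_self N),
      if_neg (ha N (Nat.lt_succ_self N)).not_gt, add_zero]

lemma wordMajorIndex_blockWord_succ_of_lt {N p a b : ℕ} {w : ℕ → ℕ} (hp : p < N) :
    wordMajorIndex (N + 3) (blockWord p a b w) =
      wordMajorIndex (N + 2) (blockWord p a b w) + if w N < w (N - 1) then N + 2 else 0 := by
  obtain ⟨N, rfl⟩ := Nat.exists_eq_succ_of_ne_zero (by omega : N ≠ 0)
  rw [wordMajorIndex_succ, blockWord_add_two w hp.le, Nat.succ_eq_add_one,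
    show N + 1 + 2 - 1 = N + 2 by omega, blockWord_add_two w (by omega), Nat.add_sub_cancel]

lemma wordMajorIndex_blockWord_succ_self {N a b : ℕ} {w : ℕ → ℕ} (hb : w N < b) :
    wordMajorIndex (N + 3) (blockWord N a b w) =
      wordMajorIndex (N + 2) (blockWord N a b w) + (N + 2) := by
  rw [wordMajorIndex_succ, blockWord_add_two w le_rfl, show N + 2 - 1 = N + 1 by omega,
    blockWord_succ, if_pos hb]

/-- The signed sum over all insertions of a block of two large letters, in either order. -/
theorem sum_blockWord {R : Type*} [CommRing R] (q : R) {N a b : ℕ} {w : ℕ → ℕ} (hab : a < b)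
    (ha : ∀ i < N, w i < a) :
    (1 - q ^ 2) * ∑ p ∈ Finset.range (N + 1), (q ^ wordMajorIndex (N + 2) (blockWord p a b w) -
        q ^ wordMajorIndex (N + 2) (blockWord p b a w)) =
      q ^ wordMajorIndex N w * ((1 - q ^ (N + 1)) * (1 - q ^ (N + 2))) := by
  induction N with
  | zero =>
    rw [Finset.sum_range_one, wordMajorIndex_blockWord_end (by simp),
      wordMajorIndex_blockWord_end (by simp), if_pos hab, if_neg hab.not_gt]
    simp [wordMajorIndex]
    ring
  | succ N ih =>
    have ha' : ∀ i < N, w i < a := fun i hi => ha i (by omega)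
    have hN : w N < a := ha N (Nat.lt_succ_self N)
    replace ih := ih ha'
    rw [Finset.sum_range_succ, wordMajorIndex_blockWord_end ha',
      wordMajorIndex_blockWord_end fun i hi => (ha' i hi).trans hab, if_pos hab,
      if_neg hab.not_gt] at ih
    rw [Finset.sum_range_succ, Finset.sum_range_succ, wordMajorIndex_blockWord_end ha,
      wordMajorIndex_blockWord_end fun i hi => (ha i hi).trans hab, if_pos hab,
      if_neg hab.not_gt, wordMajorIndex_blockWord_succ_self (hN.trans hab),
      wordMajorIndex_blockWord_succ_self hN, wordMajorIndex_blockWord_end ha',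
      wordMajorIndex_blockWord_end fun i hi => (ha' i hi).trans hab, if_pos hab,
      if_neg hab.not_gt, wordMajorIndex_succ N]
    -- For `p < N` the last two letters are not both touched by the block order: appending `w N`
    -- after `w (N - 1)` multiplies every term by the same factor. Only the positions `N` and `N +
    -- 1` need separate values.
    have hsum : ∑ p ∈ Finset.range N, (q ^ wordMajorIndex (N + 3) (blockWord p a b w) -
        q ^ wordMajorIndex (N + 3) (blockWord p b a w)) =
        (if w N < w (N - 1) then q ^ (N + 2) else 1) * ∑ p ∈ Finset.range N,
          (q ^ wordMajorIndex (N + 2) (blockWord p a b w) -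
            q ^ wordMajorIndex (N + 2) (blockWord p b a w)) := by
      rw [Finset.mul_sum]
      refine Finset.sum_congr rfl fun p hp => ?_
      rw [wordMajorIndex_blockWord_succ_of_lt (Finset.mem_range.1 hp),
        wordMajorIndex_blockWord_succ_of_lt (Finset.mem_range.1 hp)]
      split_ifs <;> ring
    rw [show N + 1 + 2 = N + 3 from rfl, hsum]
    split_ifs with h
    · linear_combination q ^ (N + 2) * ih
    · linear_combination ih

section insertMax

variable {n : ℕ}

/-- Insert the largest letter into a permutation at position `p`. -/
def insertMax (p : Fin (n + 1)) (τ : Perm (Fin n)) : Perm (Fin (n + 1)) :=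
  (finRotate (n + 1))⁻¹ * Perm.decomposeFin.symm (0, τ) * p.cycleRange

@[simp] lemma insertMax_apply_self (p : Fin (n + 1)) (τ : Perm (Fin n)) :
    insertMax p τ p = Fin.last n := by
  rw [insertMax, Perm.mul_apply, Perm.mul_apply, Perm.inv_eq_iff_eq]
  simp

@[simp] lemma insertMax_apply_succAbove (p : Fin (n + 1)) (τ : Perm (Fin n)) (i : Fin n) :
    insertMax p τ (p.succAbove i) = (τ i).castSucc := by
  rw [insertMax, Perm.mul_apply, Perm.mul_apply, Perm.inv_eq_iff_eq]
  simp

/-- `p.cycleRange` brings position `p` to `0`, the middle factor applies `τ` to the rest, and the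
inverse rotation turns the value `0` into the largest one; the outer factors contribute `(-1) ^ p`
and `(-1) ^ n`. -/
lemma sign_insertMax (p : Fin (n + 1)) (τ : Perm (Fin n)) :
    Perm.sign (insertMax p τ) = (-1) ^ (n + p) * Perm.sign τ := by
  rw [insertMax, Perm.sign_mul, Perm.sign_mul, Perm.sign_inv, sign_finRotate,
    Perm.decomposeFin.symm_sign, Fin.sign_cycleRange]
  simp [pow_add, mul_right_comm]

lemma insertMax_bijective :
    Function.Bijective fun x : Fin (n + 1) × Perm (Fin n) => insertMax x.1 x.2 := by
  rw [Fintype.bijective_iff_injective_and_card]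
  constructor
  · rintro ⟨p, τ⟩ ⟨p', τ'⟩ h
    simp only at h
    have hp : p = p' := by
      apply (insertMax p τ).injective
      rw [insertMax_apply_self, h, insertMax_apply_self]
    subst hp
    refine Prod.ext rfl (Equiv.ext fun i => Fin.castSucc_injective n ?_)
    rw [← insertMax_apply_succAbove p, h, insertMax_apply_succAbove]
  · simp [Fintype.card_perm, Nat.factorial_succ]

lemma sum_perm_eq_sum_insertMax {M : Type*} [AddCommMonoid M] (f : Perm (Fin (n + 1)) → M) :
    ∑ σ, f σ = ∑ τ : Perm (Fin n), ∑ p, f (insertMax p τ) := by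
  rw [← insertMax_bijective.sum_comp, Fintype.sum_prod_type, Finset.sum_comm]

lemma permWord_insertMax (p : Fin (n + 1)) (τ : Perm (Fin n)) {i : ℕ} (hi : i < n + 1) :
    permWord (insertMax p τ) i =
      if i < p then permWord τ i else if i = p then n else permWord τ (i - 1) := by
  obtain ⟨j, rfl⟩ : ∃ j : Fin (n + 1), (j : ℕ) = i := ⟨⟨i, hi⟩, rfl⟩
  rw [permWord_val]
  rcases Fin.eq_self_or_eq_succAbove p j with rfl | ⟨l, rfl⟩
  · simp
  · rw [insertMax_apply_succAbove, Fin.val_castSucc, ← permWord_val]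
    rcases lt_or_ge l.castSucc p with h | h
    · rw [Fin.succAbove_of_castSucc_lt _ _ h]
      rw [Fin.lt_def] at h
      rw [if_pos h, Fin.val_castSucc]
    · rw [Fin.succAbove_of_le_castSucc _ _ h]
      rw [Fin.le_def, Fin.val_castSucc] at h
      rw [Fin.val_succ, if_neg (by omega), if_neg (by omega), Nat.add_sub_cancel]

lemma majorIndex_insertMax_succ (p : Fin (n + 1)) (τ : Perm (Fin n)) :
    majorIndex (insertMax p.succ (insertMax p τ)) =
      wordMajorIndex (n + 2) (blockWord p n (n + 1) (permWord τ)) := by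
  rw [majorIndex_eq_wordMajorIndex]
  refine wordMajorIndex_eq_of_eqOn fun i hi => ?_
  rw [permWord_insertMax _ _ hi, blockWord, Fin.val_succ]
  have := p.2
  split_ifs <;> first | omega | rfl | (rw [permWord_insertMax _ _ (by omega)]; split_ifs <;>
    first | omega | rfl)

lemma majorIndex_insertMax_castSucc (p : Fin (n + 1)) (τ : Perm (Fin n)) :
    majorIndex (insertMax p.castSucc (insertMax p τ)) =
      wordMajorIndex (n + 2) (blockWord p (n + 1) n (permWord τ)) := by
  rw [majorIndex_eq_wordMajorIndex]
  refine wordMajorIndex_eq_of_eqOn fun i hi => ?_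
  rw [permWord_insertMax _ _ hi, blockWord, Fin.val_castSucc]
  have := p.2
  split_ifs <;> first | omega | rfl | (rw [permWord_insertMax _ _ (by omega)]; split_ifs <;>
    first | omega | rfl)

/-- The two largest letters of `σ` stand next to each other. -/
def TopAdjacent (σ : Perm (Fin (n + 2))) : Prop :=
  (σ.symm (Fin.last n).castSucc : ℕ) + 1 = σ.symm (Fin.last (n + 1)) ∨
    (σ.symm (Fin.last (n + 1)) : ℕ) + 1 = σ.symm (Fin.last n).castSucc

lemma topAdjacent_insertMax {p : Fin (n + 1)} {p' : Fin (n + 2)} {τ : Perm (Fin n)} :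
    TopAdjacent (insertMax p' (insertMax p τ)) ↔ p' = p.castSucc ∨ p' = p.succ := by
  have h1 : (insertMax p' (insertMax p τ)).symm (Fin.last (n + 1)) = p' := by
    rw [Equiv.symm_apply_eq, insertMax_apply_self]
  have h2 : (insertMax p' (insertMax p τ)).symm (Fin.last n).castSucc = p'.succAbove p := by
    rw [Equiv.symm_apply_eq, insertMax_apply_succAbove, insertMax_apply_self]
  rw [TopAdjacent, h1, h2, Fin.ext_iff, Fin.ext_iff, Fin.val_castSucc, Fin.val_succ]
  rcases lt_or_ge p.castSucc p' with h | h
  · rw [Fin.succAbove_of_castSucc_lt _ _ h]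
    rw [Fin.lt_def, Fin.val_castSucc] at h
    rw [Fin.val_castSucc]; omega
  · rw [Fin.succAbove_of_le_castSucc _ _ h]
    rw [Fin.le_def, Fin.val_castSucc] at h
    rw [Fin.val_succ]; omega

/-- Exchange the two largest letters. -/
def topSwap (n : ℕ) : Perm (Fin (n + 2)) := swap (Fin.last n).castSucc (Fin.last (n + 1))

lemma sign_topSwap_mul (σ : Perm (Fin (n + 2))) :
    Perm.sign (topSwap n * σ) = -Perm.sign σ := by
  rw [Perm.sign_mul, topSwap, Perm.sign_swap (Fin.castSucc_lt_last _).ne, neg_one_mul]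

lemma topAdjacent_topSwap_mul {σ : Perm (Fin (n + 2))} :
    TopAdjacent (topSwap n * σ) ↔ TopAdjacent σ := by
  have h : ∀ x, (topSwap n * σ).symm x = σ.symm (topSwap n x) := fun x => by
    rw [Equiv.symm_apply_eq, Perm.mul_apply, Equiv.apply_symm_apply, topSwap, Equiv.swap_apply_self]
  rw [TopAdjacent, TopAdjacent, h, h, topSwap, Equiv.swap_apply_left, Equiv.swap_apply_right,
    or_comm]

/-- The exchanged values are consecutive, so only their mutual comparison changes. -/
lemma topSwap_lt_iff {x y : Fin (n + 2)}
    (h1 : ¬ (x = (Fin.last n).castSucc ∧ y = Fin.last (n + 1)))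
    (h2 : ¬ (y = (Fin.last n).castSucc ∧ x = Fin.last (n + 1))) :
    topSwap n x < topSwap n y ↔ x < y := by
  have := x.2
  have := y.2
  simp only [topSwap, Equiv.swap_apply_def]
  simp only [Fin.ext_iff, Fin.lt_def, Fin.val_castSucc, Fin.val_last] at *
  split_ifs <;> simp only [Fin.val_castSucc, Fin.val_last] <;> omega

lemma majorIndex_topSwap_mul {σ : Perm (Fin (n + 2))} (h : ¬ TopAdjacent σ) :
    majorIndex (topSwap n * σ) = majorIndex σ := by
  rw [majorIndex_eq_wordMajorIndex, majorIndex_eq_wordMajorIndex]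
  refine wordMajorIndex_congr fun i hi => ?_
  rw [permWord_of_lt _ hi, permWord_of_lt _ hi, permWord_of_lt _ (by omega : i < n + 2),
    permWord_of_lt _ (by omega : i < n + 2), ← Fin.lt_def, ← Fin.lt_def]
  refine topSwap_lt_iff (fun ⟨h1, h2⟩ => h (Or.inr ?_)) (fun ⟨h1, h2⟩ => h (Or.inl ?_)) <;>
    rw [← h1, ← h2, Equiv.symm_apply_apply, Equiv.symm_apply_apply]

end insertMax

section

variable {R : Type*} [CommRing R] (q : R)

-- Left multiplication by `topSwap n` is a sign-reversing involution that keeps the major index when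
-- the two largest letters are apart.
open Classical in
lemma sum_not_topAdjacent (n : ℕ) :
    signedMajSum q (Finset.univ.filter fun σ : Perm (Fin (n + 2)) => ¬ TopAdjacent σ) = 0 := by
  refine Finset.sum_involution (fun σ _ => topSwap n * σ) ?_ ?_ ?_ ?_
  · intro σ hσ
    rw [majorIndex_topSwap_mul (Finset.mem_filter.1 hσ).2, sign_topSwap_mul]
    simp
  · intro σ _ _ h
    have := sign_topSwap_mul σ
    rw [h] at this
    exact units_ne_neg_self _ this
  · intro σ hσ
    rw [Finset.mem_filter, topAdjacent_topSwap_mul]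
    exact ⟨Finset.mem_univ _, (Finset.mem_filter.1 hσ).2⟩
  · intro σ _
    rw [topSwap, Equiv.swap_mul_self_mul]

/-- The surviving permutations insert the two largest letters as a block into some `τ`: the
increasing block carries `sign τ`, the decreasing one its negative, and `sum_blockWord` sums over
the positions. -/
theorem signedMajSum_univ_add_two (n : ℕ) :
    (1 - q ^ 2) * signedMajSum q (Finset.univ : Finset (Perm (Fin (n + 2)))) =
      (1 - q ^ (n + 1)) * (1 - q ^ (n + 2)) *
        signedMajSum q (Finset.univ : Finset (Perm (Fin n))) := by
  classical
  have h1 : signedMajSum q (Finset.univ : Finset (Perm (Fin (n + 2)))) =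
      signedMajSum q (Finset.univ.filter fun σ : Perm (Fin (n + 2)) => TopAdjacent σ) := by
    have := sum_not_topAdjacent q n
    rw [signedMajSum] at this ⊢
    rw [← Finset.sum_filter_add_sum_filter_not _ TopAdjacent, this, add_zero, signedMajSum]
  rw [h1, signedMajSum, Finset.sum_filter, sum_perm_eq_sum_insertMax, sum_perm_eq_sum_insertMax,
    signedMajSum, Finset.mul_sum, Finset.mul_sum]
  refine Finset.sum_congr rfl fun τ _ => ?_
  have h2 : ∀ p : Fin (n + 1), (∑ p', if TopAdjacent (insertMax p' (insertMax p τ)) then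
      ((Perm.sign (insertMax p' (insertMax p τ)) : ℤ) : R) *
        q ^ majorIndex (insertMax p' (insertMax p τ)) else 0) =
      ((Perm.sign τ : ℤ) : R) *
        (q ^ wordMajorIndex (n + 2) (blockWord p n (n + 1) (permWord τ)) -
          q ^ wordMajorIndex (n + 2) (blockWord p (n + 1) n (permWord τ))) := by
    intro p
    simp only [topAdjacent_insertMax]
    rw [← Finset.sum_filter, Finset.filter_or, Finset.sum_union, Finset.filter_eq',
      Finset.filter_eq', if_pos (Finset.mem_univ _), if_pos (Finset.mem_univ _),
      Finset.sum_singleton, Finset.sum_singleton, majorIndex_insertMax_castSucc,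
      majorIndex_insertMax_succ, sign_insertMax, sign_insertMax, sign_insertMax, sign_insertMax,
      Fin.val_succ, Fin.val_castSucc]
    · have e1 : ((-1 : ℤˣ)) ^ (n + 1 + (p : ℕ)) * ((-1) ^ (n + (p : ℕ)) * Perm.sign τ) =
          -Perm.sign τ := by
        rw [← mul_assoc, ← pow_add, Odd.neg_one_pow ⟨n + p, by omega⟩, neg_one_mul]
      have e2 : ((-1 : ℤˣ)) ^ (n + 1 + ((p : ℕ) + 1)) * ((-1) ^ (n + (p : ℕ)) * Perm.sign τ) =
          Perm.sign τ := by
        rw [← mul_assoc, ← pow_add, Even.neg_one_pow ⟨n + p + 1, by omega⟩, one_mul]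
      rw [e1, e2]
      push_cast
      ring
    · rw [Finset.disjoint_filter]
      rintro _ _ rfl h
      exact (Fin.castSucc_lt_succ).ne h
  have h3 := sum_blockWord q (N := n) (w := permWord τ) (Nat.lt_succ_self n) fun i hi => by
    rw [permWord_of_lt τ hi]; exact (τ _).2
  rw [Finset.sum_congr rfl fun p _ => h2 p, ← Finset.mul_sum, Fin.sum_univ_eq_sum_range
    (fun p => q ^ wordMajorIndex (n + 2) (blockWord p n (n + 1) (permWord τ)) -
      q ^ wordMajorIndex (n + 2) (blockWord p (n + 1) n (permWord τ))), mul_left_comm, h3,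
    majorIndex_eq_wordMajorIndex]
  ring

end

/-! ### q-factorials and inversion of the q-exponential -/

lemma sum_neg_one_pow_mul_gaussBinom {R : Type*} [CommRing R] (q : R) (n : ℕ) :
    ∑ k ∈ Finset.range (n + 2), (-1) ^ k * q ^ Nat.choose k 2 * gaussBinom q (n + 1) k = 0 := by
  rw [Finset.sum_range_succ']
  -- Pascal's rule makes the sum telescope; what remains is `-1`, cancelling the split-off term `k =
  -- 0`.
  have h : ∀ k ∈ Finset.range (n + 1),
      (-1) ^ (k + 1) * q ^ Nat.choose (k + 1) 2 * gaussBinom q (n + 1) (k + 1) =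
        (-1) ^ (k + 1) * q ^ Nat.choose (k + 2) 2 * gaussBinom q n (k + 1) -
          (-1) ^ k * q ^ Nat.choose (k + 1) 2 * gaussBinom q n k := by
    intro k _
    rw [gaussBinom_succ_succ, Nat.choose_succ_succ' (k + 1) 1, Nat.choose_one_right]
    ring
  rw [Finset.sum_congr rfl h, Finset.sum_range_sub
    (fun k => (-1) ^ k * q ^ Nat.choose (k + 1) 2 * gaussBinom q n k),
    gaussBinom_eq_zero_of_lt q (Nat.lt_succ_self n)]
  simp

lemma one_sub_mul_qInteger {R : Type*} [CommRing R] (q : R) (k : ℕ) :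
    (1 - q) * qInteger q k = 1 - q ^ k :=
  mul_neg_geom_sum q k

lemma qFactorial_zero {R : Type*} [CommSemiring R] (q : R) : qFactorial q 0 = 1 := by
  simp [qFactorial]

lemma qFactorial_succ {R : Type*} [CommSemiring R] (q : R) (k : ℕ) :
    qFactorial q (k + 1) = qFactorial q k * qInteger q (k + 1) :=
  Finset.prod_Icc_succ_top (by omega) _

section

variable {K : Type*} [Field K] {q : K} (hq : ∀ k, 1 ≤ k → q ^ k ≠ 1)

include hq

lemma one_sub_ne_zero_of_pow_ne_one : 1 - q ≠ 0 :=
  sub_ne_zero.2 fun h => hq 1 le_rfl (by rw [← h, one_pow])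

lemma one_add_ne_zero_of_pow_ne_one : 1 + q ≠ 0 := fun h =>
  hq 2 one_le_two (by linear_combination (q - 1) * h)

/-- A vanishing factor `qInteger q i` would force `q ^ i = 1`. -/
lemma qFactorial_ne_zero (k : ℕ) : qFactorial q k ≠ 0 := by
  refine Finset.prod_ne_zero_iff.2 fun i hi h => hq i (Finset.mem_Icc.1 hi).1 ?_
  have := one_sub_mul_qInteger q i
  rw [h, mul_zero] at this
  exact (sub_eq_zero.1 this.symm).symm

lemma gaussBinom_mul_qFactorial (k m : ℕ) :
    gaussBinom q (k + m) k * (qFactorial q k * qFactorial q m) = qFactorial q (k + m) := by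
  induction k generalizing m with
  | zero => simp [qFactorial_zero]
  | succ k ih =>
    have h1 := ih (m + 1)
    have h2 := one_sub_pow_mul_gaussBinom q k (m + 1)
    have e1 := one_sub_mul_qInteger q (k + 1)
    have e2 := one_sub_mul_qInteger q (m + 1)
    rw [show k + 1 + m = k + (m + 1) by omega]
    apply mul_left_cancel₀ (one_sub_ne_zero_of_pow_ne_one hq)
    rw [qFactorial_succ] at h1 ⊢
    linear_combination (1 - q) * h1 + qFactorial q k * qFactorial q m * h2 +
      gaussBinom q (k + (m + 1)) (k + 1) * qFactorial q k * qFactorial q m * e1 -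
      gaussBinom q (k + (m + 1)) k * qFactorial q k * qFactorial q m * e2

lemma gaussBinom_div_qFactorial (k m : ℕ) :
    gaussBinom q (k + m) k / qFactorial q (k + m) = (qFactorial q k)⁻¹ * (qFactorial q m)⁻¹ := by
  have hk := qFactorial_ne_zero hq k
  have hm := qFactorial_ne_zero hq m
  rw [div_eq_iff (qFactorial_ne_zero hq _), ← gaussBinom_mul_qFactorial hq k m]
  field_simp

/-- The Gessel–Simion formula for the signed generating function of the major index. -/
theorem signedMajSum_univ_eq (n : ℕ) :
    signedMajSum q (Finset.univ : Finset (Perm (Fin n))) =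
      qFactorial q n * ((1 - q) / (1 + q)) ^ (n / 2) := by
  induction n using Nat.twoStepInduction with
  | zero => simp [signedMajSum, qFactorial_zero, majorIndex_eq_wordMajorIndex, wordMajorIndex]
  | one => simp [signedMajSum, qFactorial, qInteger, majorIndex_eq_wordMajorIndex, wordMajorIndex]
  | more n ih _ =>
    have h := signedMajSum_univ_add_two q n
    have h1 := one_sub_ne_zero_of_pow_ne_one hq
    have h2 := one_add_ne_zero_of_pow_ne_one hq
    have e1 := one_sub_mul_qInteger q (n + 1)
    have e2 := one_sub_mul_qInteger q (n + 2)
    have h3 : 1 - q ^ 2 = (1 - q) * (1 + q) := by ring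
    apply mul_left_cancel₀ (mul_ne_zero h1 h2)
    rw [← h3, h, ih, ← e1, ← e2, qFactorial_succ, qFactorial_succ,
      Nat.add_div_right n (by norm_num), pow_succ _ (n / 2), h3]
    field_simp

-- Up to a q-factorial, each higher coefficient of the product is the alternating sum
-- `sum_neg_one_pow_mul_gaussBinom`.
open PowerSeries in
lemma qExp_mul_qExp_inv :
    (PowerSeries.mk fun k => (-1) ^ k * q ^ Nat.choose k 2 * (qFactorial q k)⁻¹) *
      (PowerSeries.mk fun k => (qFactorial q k)⁻¹) = 1 := by
  ext n
  simp only [coeff_mul, coeff_mk, coeff_one]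
  cases n with
  | zero => simp [qFactorial_zero]
  | succ n =>
    rw [if_neg (Nat.succ_ne_zero n)]
    have h : ∀ p ∈ Finset.HasAntidiagonal.antidiagonal (n + 1),
        (-1) ^ p.1 * q ^ Nat.choose p.1 2 * (qFactorial q p.1)⁻¹ * (qFactorial q p.2)⁻¹ =
          ((-1) ^ p.1 * q ^ Nat.choose p.1 2 * gaussBinom q (n + 1) p.1) /
            qFactorial q (n + 1) := by
      intro p hp
      rw [← Finset.HasAntidiagonal.mem_antidiagonal.1 hp, mul_div_assoc, gaussBinom_div_qFactorial hq, mul_assoc]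
    rw [Finset.sum_congr rfl h, ← Finset.sum_div, Finset.Nat.sum_antidiagonal_eq_sum_range_succ_mk,
      sum_neg_one_pow_mul_gaussBinom, zero_div]

open PowerSeries in
theorem signedMajSum_derangements (n : ℕ) :
    signedMajSum q (derangementFinset n) =
      qFactorial q n * ∑ k ∈ Finset.range (n + 1),
        (-1) ^ k / qFactorial q k * q ^ Nat.choose k 2 *
          ((1 - q) / (1 + q)) ^ ((n - k) / 2) := by
  set A : PowerSeries K := .mk fun k => signedMajSum q (derangementFinset k) / qFactorial q k
  set E : PowerSeries K := .mk fun k => (qFactorial q k)⁻¹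
  set B : PowerSeries K := .mk fun k => (-1) ^ k * q ^ Nat.choose k 2 * (qFactorial q k)⁻¹
  -- The support decomposition of the full signed sum, divided by `qFactorial q m`, is the
  -- coefficient of this product.
  have hAE : A * E = .mk fun m => ((1 - q) / (1 + q)) ^ (m / 2) := by
    ext m
    simp only [A, E, coeff_mul, coeff_mk]
    rw [← mul_right_inj' (qFactorial_ne_zero hq m), ← signedMajSum_univ_eq hq,
      signedMajSum_univ_eq_sum_derangements, Finset.mul_sum,
      ← Finset.Nat.sum_antidiagonal_eq_sum_range_succ_mk
        (fun p : ℕ × ℕ => gaussBinom q m p.1 * signedMajSum q (derangementFinset p.1))]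
    refine Finset.sum_congr rfl fun p hp => ?_
    have h := gaussBinom_div_qFactorial hq p.1 p.2
    rw [Finset.HasAntidiagonal.mem_antidiagonal.1 hp, div_eq_iff (qFactorial_ne_zero hq m)] at h
    rw [h]
    ring
  have hA : A = B * (A * E) := by
    rw [mul_left_comm, qExp_mul_qExp_inv hq, mul_one]
  have h := congrArg (coeff n) hA
  rw [hAE, coeff_mul, Finset.Nat.sum_antidiagonal_eq_sum_range_succ_mk] at h
  simp only [A, B, coeff_mk] at h
  rw [div_eq_iff (qFactorial_ne_zero hq n), mul_comm] at h
  rw [h]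
  congr 1
  refine Finset.sum_congr rfl fun k _ => ?_
  ring

end

/-! ### Specialisation to rational functions -/

lemma ratFunc_X_pow_ne_one {F : Type*} [Field F] (k : ℕ) (hk : 1 ≤ k) :
    (RatFunc.X : RatFunc F) ^ k ≠ 1 := by
  rw [← RatFunc.algebraMap_X, ← map_pow, ← map_one (algebraMap (Polynomial F) (RatFunc F))]
  intro h
  have := congrArg Polynomial.natDegree (RatFunc.algebraMap_injective F h)
  rw [Polynomial.natDegree_X_pow, Polynomial.natDegree_one] at this
  omega

theorem mainTheorem3 (n : ℕ) (hn : 1 ≤ n) (q : RatFunc ℚ) (hq : q = RatFunc.X) :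
    (∑ σ ∈ derangementFinset n, (-1) ^ coxeterLength σ * q ^ majorIndex σ =
      qFactorial q n * ∑ k ∈ Finset.range (n + 1),
        (-1) ^ k / qFactorial q k * q ^ Nat.choose k 2 *
          ((1 - q) / (1 + q)) ^ ((n - k) / 2)) ∧
    (∑ σ ∈ derangementFinset n, (-1) ^ inversionNumber σ * q ^ majorIndex σ =
      qFactorial q n * ∑ k ∈ Finset.range (n + 1),
        (-1) ^ k / qFactorial q k * q ^ Nat.choose k 2 *
          ((1 - q) / (1 + q)) ^ ((n - k) / 2)) := by
  have h := signedMajSum_derangements (q := q) (by rw [hq]; exact ratFunc_X_pow_ne_one) n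
  rw [← h, signedMajSum]
  constructor <;> refine Finset.sum_congr rfl fun σ _ => ?_
  · rw [sign_eq_neg_one_pow_coxeterLength]
    push_cast
    rfl
  · rw [sign_eq_neg_one_pow_inversionNumber]
    push_cast
    rfl
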